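/- For an integer $n\ge 1$ let $H=-\Delta+|x|^2$ be the Hermite operator on $L^2(\mathbb R^n)$. With the normalized Hermite functions $\Phi_\alpha$, $\alpha\in\mathbb N_0^n$, which form an orthonormal basis with $H\Phi_\alpha=(2|\alpha|+n)\Phi_\alpha$, its propagator is $e^{-itH}f=\sum_\alpha e^{-it(2|\alpha|+n)}\langle\Phi_\alpha,f\rangle\Phi_\alpha$. For $1\le r<\infty$ let $\mathfrak S^r$ be the Schatten class of compact operators $\gamma$ on $L^2(\mathbb R^n)$ with $\|\gamma\|_{\mathfrak S^r}=\big(\sum_k s_k(\gamma)^r\big)^{1/r}<\infty$, where the $s_k(\gamma)$ are the eigenvalues of $\sqrt{\gamma^*\gamma}$ counted with multiplicity. If $\gamma=\sum_j n_j|u_j\rangle\langle u_j|$ with $(u_j)$ an orthonormal system and $n_j\in\mathbb C$, its density is $\rho_\gamma=\sum_j n_j|u_j|^2$, provided that this series converges unconditionally almost everywhere. Write $\mathbb T=\mathbb R/2\pi\mathbb Z$, identified with $(-\pi,\pi]$. **Proposition (optimality of the Schatten exponent).** Let $n\ge 1$ be an integer and let $p,q\in[1,\infty]$ satisfy $\frac2p+\frac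 nq=n$ (with $\frac1\infty=0$). Then $$\sup_{\gamma_0}\ \frac{\big\|\rho_{e^{-itH}\gamma_0e^{itH}}\big\|_{L^p_tL^q_x(\mathbb T\times\mathbb R^n)}}{\|\gamma_0\|_{\mathfrak S^r}}=+\infty$$ for every real $r>\frac{2q}{q+1}$ (read as $r>2$ if $q=\infty$), where the supremum is over all $0\ne\gamma_0\in\mathfrak S^r$ for which the density of $e^{-itH}\gamma_0e^{itH}$ is defined for every $t$. -/

import Mathlib

open MeasureTheory Filter Topology
open scoped ENNReal NNReal InnerProductSpace Polynomial

noncomputable section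

namespace HermiteSchatten

/-! ### Hermite polynomials and Hermite functions on the line -/

/-- The (physicists') Hermite polynomial `H_k(x) = (-1)^k (d/dx)^k (e^{-x²}) e^{x²}`. -/
def hermiteH (k : ℕ) (x : ℝ) : ℝ :=
  (-1) ^ k * iteratedDeriv k (fun y : ℝ => Real.exp (-y ^ 2)) x * Real.exp (x ^ 2)

/-- The normalized Hermite function `h_k(x) = (2^k √π k!)^{-1/2} H_k(x) e^{-x²/2}`. -/
def hermiteFun (k : ℕ) (x : ℝ) : ℝ :=
  (Real.sqrt (2 ^ k * Real.sqrt Real.pi * (k.factorial : ℝ)))⁻¹ * hermiteH k x *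
    Real.exp (-(x ^ 2 / 2))

/-- Auxiliary polynomials with `hermiteH k x = (hermitePoly k).eval x`. -/
def hermitePoly : ℕ → ℝ[X]
  | 0 => 1
  | k + 1 => Polynomial.C 2 * Polynomial.X * hermitePoly k - Polynomial.derivative (hermitePoly k)

lemma hasDerivAt_poly_gauss (P : ℝ[X]) (x : ℝ) :
    HasDerivAt (fun y : ℝ => P.eval y * Real.exp (-y ^ 2))
      (-((Polynomial.C 2 * Polynomial.X * P - Polynomial.derivative P).eval x *
        Real.exp (-x ^ 2))) x := by
  have h1 := P.hasDerivAt x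
  have h2 : HasDerivAt (fun y : ℝ => Real.exp (-y ^ 2)) (Real.exp (-x ^ 2) * (-(2 * x))) x := by
    have := ((hasDerivAt_pow 2 x).neg).exp
    simpa using this
  refine (h1.mul h2).congr_deriv ?_
  simp only [Polynomial.eval_sub, Polynomial.eval_mul, Polynomial.eval_C, Polynomial.eval_X]
  ring

lemma iteratedDeriv_gauss (k : ℕ) :
    iteratedDeriv k (fun y : ℝ => Real.exp (-y ^ 2)) =
      fun x => (-1) ^ k * ((hermitePoly k).eval x * Real.exp (-x ^ 2)) := by
  induction k with
  | zero => simp [hermitePoly]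
  | succ k ih =>
    rw [iteratedDeriv_succ, ih]
    funext x
    rw [((hasDerivAt_poly_gauss (hermitePoly k) x).const_mul ((-1) ^ k)).deriv, hermitePoly]
    ring

lemma hermiteH_eq (k : ℕ) (x : ℝ) : hermiteH k x = (hermitePoly k).eval x := by
  have h : Real.exp (-x ^ 2) * Real.exp (x ^ 2) = 1 := by
    rw [← Real.exp_add]; simp
  have h' : ((-1 : ℝ)) ^ k * (-1) ^ k = 1 := by
    rw [← mul_pow]; simp
  rw [hermiteH, iteratedDeriv_gauss]
  calc _ = ((-1 : ℝ) ^ k * (-1) ^ k) * (hermitePoly k).eval x *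
        (Real.exp (-x ^ 2) * Real.exp (x ^ 2)) := by ring
    _ = _ := by rw [h, h']; ring

lemma derivative_hermitePoly (k : ℕ) :
    Polynomial.derivative (hermitePoly (k + 1)) =
      Polynomial.C (2 * ((k : ℝ) + 1)) * hermitePoly k := by
  induction k with
  | zero => simp [hermitePoly]
  | succ k ih =>
    have e : hermitePoly (k + 1 + 1) = Polynomial.C 2 * Polynomial.X * hermitePoly (k + 1) -
      Polynomial.derivative (hermitePoly (k + 1)) := rfl
    have e' : hermitePoly (k + 1) = Polynomial.C 2 * Polynomial.X * hermitePoly k -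
      Polynomial.derivative (hermitePoly k) := rfl
    rw [e, ih]
    simp only [Polynomial.derivative_sub, Polynomial.derivative_mul, Polynomial.derivative_C,
      Polynomial.derivative_X, ih]
    rw [e']
    simp only [map_mul, map_add, Polynomial.C_ofNat, Nat.cast_add, Nat.cast_one, map_one,
      zero_mul, mul_one, zero_add]
    ring

lemma integrable_poly_gauss (P : ℝ[X]) :
    Integrable (fun x : ℝ => P.eval x * Real.exp (-x ^ 2)) := by
  induction P using Polynomial.induction_on' with
  | add P Q hP hQ =>
    refine (hP.add hQ).congr (ae_of_all _ fun x => ?_)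
    simp [add_mul]
  | monomial k a =>
    have h := (integrable_rpow_mul_exp_neg_mul_sq (b := 1) one_pos (s := k)
      (by have : (0 : ℝ) ≤ k := Nat.cast_nonneg k
          linarith)).const_mul a
    refine h.congr (ae_of_all _ fun x => ?_)
    simp [mul_assoc]

lemma integral_hermitePoly_succ (Q : ℝ[X]) (k : ℕ) :
    ∫ x : ℝ, (Q * hermitePoly (k + 1)).eval x * Real.exp (-x ^ 2) =
      ∫ x : ℝ, (Polynomial.derivative Q * hermitePoly k).eval x * Real.exp (-x ^ 2) := by
  have h := integral_mul_deriv_eq_deriv_mul_of_integrable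
    (u := fun x : ℝ => Q.eval x) (u' := fun x => (Polynomial.derivative Q).eval x)
    (v := fun x : ℝ => (hermitePoly k).eval x * Real.exp (-x ^ 2))
    (v' := fun x => -((hermitePoly (k + 1)).eval x * Real.exp (-x ^ 2)))
    (fun x _ => Q.hasDerivAt x) (fun x _ => hasDerivAt_poly_gauss (hermitePoly k) x)
    (by
      refine (integrable_poly_gauss (Q * hermitePoly (k + 1))).neg.congr (ae_of_all _ fun x => ?_)
      simp [mul_assoc])
    (by
      refine (integrable_poly_gauss (Polynomial.derivative Q * hermitePoly k)).congr
        (ae_of_all _ fun x => ?_)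
      simp [mul_assoc])
    (by
      refine (integrable_poly_gauss (Q * hermitePoly k)).congr (ae_of_all _ fun x => ?_)
      simp [mul_assoc])
  simp only [mul_neg, integral_neg, neg_inj] at h
  simpa [mul_assoc] using h

lemma integral_hermitePoly_mul (m k : ℕ) :
    ∫ x : ℝ, (hermitePoly m * hermitePoly k).eval x * Real.exp (-x ^ 2) =
      if m = k then 2 ^ k * Real.sqrt Real.pi * (k.factorial : ℝ) else 0 := by
  induction k generalizing m with
  | zero =>
    cases m with
    | zero =>
      have h := integral_gaussian 1
      simpa [hermitePoly] using h
    | succ m =>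
      rw [mul_comm, integral_hermitePoly_succ]
      simp [hermitePoly]
  | succ k ih =>
    rw [integral_hermitePoly_succ]
    cases m with
    | zero => simp [hermitePoly]
    | succ m =>
      have e : ∀ x : ℝ, (Polynomial.derivative (hermitePoly (m + 1)) * hermitePoly k).eval x *
          Real.exp (-x ^ 2) =
          (2 * ((m : ℝ) + 1)) * ((hermitePoly m * hermitePoly k).eval x * Real.exp (-x ^ 2)) := by
        intro x
        rw [derivative_hermitePoly]
        simp only [Polynomial.eval_mul, Polynomial.eval_C]
        ring
      simp_rw [e]
      rw [integral_const_mul, ih]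
      by_cases h : m = k
      · subst h
        simp [Nat.factorial_succ]
        ring
      · simp [h]

lemma hermiteFun_mul (m k : ℕ) (x : ℝ) :
    hermiteFun m x * hermiteFun k x =
      ((Real.sqrt (2 ^ m * Real.sqrt Real.pi * (m.factorial : ℝ)))⁻¹ *
        (Real.sqrt (2 ^ k * Real.sqrt Real.pi * (k.factorial : ℝ)))⁻¹) *
        ((hermitePoly m * hermitePoly k).eval x * Real.exp (-x ^ 2)) := by
  have h : Real.exp (-x ^ 2) = Real.exp (-(x ^ 2 / 2)) * Real.exp (-(x ^ 2 / 2)) := by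
    rw [← Real.exp_add]; congr 1; ring
  rw [hermiteFun, hermiteFun, hermiteH_eq, hermiteH_eq, h, Polynomial.eval_mul]
  ring

lemma integral_hermiteFun_mul (m k : ℕ) :
    ∫ x : ℝ, hermiteFun m x * hermiteFun k x = if m = k then 1 else 0 := by
  simp_rw [hermiteFun_mul]
  rw [integral_const_mul, integral_hermitePoly_mul]
  by_cases h : m = k
  · subst h
    have hpos : 0 < 2 ^ m * Real.sqrt Real.pi * (m.factorial : ℝ) := by positivity
    have := Real.mul_self_sqrt hpos.le
    have h0 := (Real.sqrt_pos.mpr hpos).ne'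
    simp only [if_true]
    rw [← mul_inv, this, inv_mul_cancel₀ hpos.ne']
  · simp [h]

lemma integrable_hermiteFun_mul (m k : ℕ) :
    Integrable (fun x : ℝ => hermiteFun m x * hermiteFun k x) := by
  simp_rw [hermiteFun_mul]
  exact (integrable_poly_gauss _).const_mul _

lemma continuous_hermiteFun (k : ℕ) : Continuous (hermiteFun k) := by
  have : hermiteFun k = fun x => (Real.sqrt (2 ^ k * Real.sqrt Real.pi * (k.factorial : ℝ)))⁻¹ *
      (hermitePoly k).eval x * Real.exp (-(x ^ 2 / 2)) := by
    funext x; rw [hermiteFun, hermiteH_eq]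
  rw [this]
  fun_prop

/-! ### Hermite functions on `ℝⁿ` and the Hermite propagator -/

/-- Euclidean space `ℝⁿ`. -/
abbrev Rn (n : ℕ) : Type := EuclideanSpace ℝ (Fin n)

/-- The complex Hilbert space `L²(ℝⁿ)`. -/
abbrev L2 (n : ℕ) : Type := Lp ℂ 2 (volume : Measure (Rn n))

/-- `Φ_α(x) = ∏_j h_{α_j}(x_j)` for a multi-index `α ∈ ℕ₀ⁿ`. -/
def Phi (n : ℕ) (α : Fin n → ℕ) (x : Rn n) : ℂ := ((∏ j, hermiteFun (α j) (x j) : ℝ) : ℂ)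

/-- The eigenvalue `2|α| + n` of `H = -Δ + |x|²` belonging to `Φ_α`. -/
def hermiteEigenvalue (n : ℕ) (α : Fin n → ℕ) : ℝ := 2 * ((∑ j, α j : ℕ) : ℝ) + (n : ℝ)

lemma continuous_Phi (n : ℕ) (α : Fin n → ℕ) : Continuous (Phi n α) := by
  unfold Phi
  refine Complex.continuous_ofReal.comp (continuous_finsetProd _ fun j _ => ?_)
  exact (continuous_hermiteFun _).comp (by fun_prop)

lemma integrable_Phi_mul (n : ℕ) (α β : Fin n → ℕ) :
    Integrable (fun x : Rn n => Phi n α x * Phi n β x) := by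
  have h : Integrable (fun x : Fin n → ℝ => ∏ j, (hermiteFun (α j) (x j) * hermiteFun (β j) (x j)))
      volume :=
    Integrable.fintype_prod (f := fun j y => hermiteFun (α j) y * hermiteFun (β j) y)
      (fun j => integrable_hermiteFun_mul (α j) (β j))
  have h2 := ((PiLp.volume_preserving_ofLp (Fin n)).integrable_comp h.aestronglyMeasurable).mpr h
  refine h2.ofReal.congr (ae_of_all _ fun x => ?_)
  simp [Phi, Finset.prod_mul_distrib]

lemma integral_Phi_mul (n : ℕ) (α β : Fin n → ℕ) :
    ∫ x : Rn n, Phi n α x * Phi n β x = if α = β then 1 else 0 := by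
  have h1 : ∀ x : Rn n, Phi n α x * Phi n β x =
      ((fun y : Fin n → ℝ =>
        ∏ j, (hermiteFun (α j) (y j) * hermiteFun (β j) (y j))) (WithLp.ofLp x) : ℝ) := by
    intro x
    simp [Phi, Finset.prod_mul_distrib]
  simp_rw [h1]
  rw [integral_complex_ofReal]
  have h2 := (PiLp.volume_preserving_ofLp (Fin n)).integral_comp
    (MeasurableEquiv.toLp 2 (Fin n → ℝ)).symm.measurableEmbedding
    (fun y : Fin n → ℝ => ∏ j, (hermiteFun (α j) (y j) * hermiteFun (β j) (y j)))
  rw [h2, integral_fintype_prod_volume_eq_prod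
    (f := fun j y => hermiteFun (α j) y * hermiteFun (β j) y)]
  simp_rw [integral_hermiteFun_mul]
  by_cases h : α = β
  · simp [h]
  · obtain ⟨j, hj⟩ := Function.ne_iff.mp h
    rw [Finset.prod_eq_zero (Finset.mem_univ j) (by simp [hj])]
    simp [h]

lemma conj_Phi (n : ℕ) (α : Fin n → ℕ) (x : Rn n) :
    (starRingEnd ℂ) (Phi n α x) = Phi n α x := Complex.conj_ofReal _

lemma memLp_Phi (n : ℕ) (α : Fin n → ℕ) : MemLp (Phi n α) 2 volume := by
  rw [memLp_two_iff_integrable_sq_norm (continuous_Phi n α).aestronglyMeasurable]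
  refine (integrable_Phi_mul n α α).norm.congr (ae_of_all _ fun x => ?_)
  simp [sq]

/-- `Φ_α` as an element of `L²(ℝⁿ)`. -/
def PhiL2 (n : ℕ) (α : Fin n → ℕ) : L2 n := (memLp_Phi n α).toLp (Phi n α)

lemma orthonormal_PhiL2 (n : ℕ) : Orthonormal ℂ (PhiL2 n) := by
  rw [orthonormal_iff_ite]
  intro α β
  rw [L2.inner_def, ← integral_Phi_mul n α β]
  refine integral_congr_ae ?_
  filter_upwards [(memLp_Phi n α).coeFn_toLp, (memLp_Phi n β).coeFn_toLp] with x h1 h2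
  rw [PhiL2, PhiL2, h1, h2]
  simp [conj_Phi, mul_comm]

/-- The phase `e^{-it(2|α|+n)}`. -/
def phase (n : ℕ) (t : ℝ) (α : Fin n → ℕ) : ℂ :=
  Complex.exp (-Complex.I * (t : ℂ) * (hermiteEigenvalue n α : ℂ))

lemma norm_phase (n : ℕ) (t : ℝ) (α : Fin n → ℕ) : ‖phase n t α‖ = 1 := by
  have : -Complex.I * (t : ℂ) * (hermiteEigenvalue n α : ℂ) =
      ((-(t * hermiteEigenvalue n α) : ℝ) : ℂ) * Complex.I := by
    push_cast; ring
  rw [phase, this, Complex.norm_exp_ofReal_mul_I]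

lemma orthonormal_phase (n : ℕ) (t : ℝ) : Orthonormal ℂ (fun α => phase n t α • PhiL2 n α) := by
  refine ⟨fun α => ?_, fun α β h => ?_⟩
  · rw [norm_smul, norm_phase, (orthonormal_PhiL2 n).1, one_mul]
  · change ⟪phase n t α • PhiL2 n α, phase n t β • PhiL2 n β⟫_ℂ = 0
    rw [inner_smul_left, inner_smul_right, (orthonormal_PhiL2 n).2 h, mul_zero, mul_zero]

/-- The unitary propagator `e^{-itH}` on `L²(ℝⁿ)`: it sends `Φ_α` to `e^{-it(2|α|+n)} Φ_α`, that is
`e^{-itH} f = ∑_α e^{-it(2|α|+n)} ⟨Φ_α, f⟩ Φ_α` (see `hasSum_propagator`). It is the coefficient map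
`f ↦ (⟨Φ_α, f⟩)_α` into `ℓ²`, followed by `(a_α) ↦ ∑_α a_α e^{-it(2|α|+n)} Φ_α`. -/
def propagator (n : ℕ) (t : ℝ) : L2 n →L[ℂ] L2 n :=
  (orthonormal_phase n t).orthogonalFamily.linearIsometry.toContinuousLinearMap ∘L
    ContinuousLinearMap.adjoint
      (orthonormal_PhiL2 n).orthogonalFamily.linearIsometry.toContinuousLinearMap

theorem hasSum_propagator (n : ℕ) (t : ℝ) (f : L2 n) :
    HasSum (fun α : Fin n → ℕ => (phase n t α * ⟪PhiL2 n α, f⟫_ℂ) • PhiL2 n α)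
      (propagator n t f) := by
  classical
  have h := (orthonormal_phase n t).orthogonalFamily.hasSum_linearIsometry
    (ContinuousLinearMap.adjoint
      (orthonormal_PhiL2 n).orthogonalFamily.linearIsometry.toContinuousLinearMap f)
  change HasSum _ ((orthonormal_phase n t).orthogonalFamily.linearIsometry
    (ContinuousLinearMap.adjoint
      (orthonormal_PhiL2 n).orthogonalFamily.linearIsometry.toContinuousLinearMap f))
  convert h using 1
  funext α
  have e : (ContinuousLinearMap.adjoint
      (orthonormal_PhiL2 n).orthogonalFamily.linearIsometry.toContinuousLinearMap f) α =
      ⟪PhiL2 n α, f⟫_ℂ := by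
    have h1 := lp.inner_single_left (𝕜 := ℂ) (G := fun _ : Fin n → ℕ => ℂ) α (1 : ℂ)
      (ContinuousLinearMap.adjoint
        (orthonormal_PhiL2 n).orthogonalFamily.linearIsometry.toContinuousLinearMap f)
    rw [ContinuousLinearMap.adjoint_inner_right] at h1
    have h2 := (orthonormal_PhiL2 n).orthogonalFamily.linearIsometry_apply_single
      (i := α) (1 : ℂ)
    rw [LinearIsometry.coe_toContinuousLinearMap, h2] at h1
    simpa using h1.symm
  rw [e]
  simp [smul_smul, mul_comm]

/-- `γ(t) = e^{-itH} γ₀ e^{itH}`. -/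
def evolve (n : ℕ) (t : ℝ) (γ₀ : L2 n →L[ℂ] L2 n) : L2 n →L[ℂ] L2 n :=
  propagator n t ∘L γ₀ ∘L propagator n (-t)

/-! ### Schatten classes, densities and mixed norms -/

section Schatten

variable {𝓗 : Type*} [NormedAddCommGroup 𝓗] [InnerProductSpace ℂ 𝓗] [CompleteSpace 𝓗]

/-- The Schatten norm `(∑ s_k(T)^r)^{1/r}`. The singular values are the eigenvalues of
`|T| = √(T*T)` counted with multiplicity, so the sum runs over all `s ≥ 0`, each weighted with the
dimension of the eigenspace of `|T|` (for `r > 0` the value `s = 0` contributes nothing). Only used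
for compact `T`, where the eigenspaces for `s > 0` are finite dimensional. -/
def schattenNorm (r : ℝ) (T : 𝓗 →L[ℂ] 𝓗) : ℝ≥0∞ :=
  (∑' s : ℝ≥0, (Module.finrank ℂ
      (Module.End.eigenspace ((CFC.abs T : 𝓗 →L[ℂ] 𝓗) : 𝓗 →ₗ[ℂ] 𝓗) ((s : ℝ) : ℂ)) : ℝ≥0∞)
    * (s : ℝ≥0∞) ^ r) ^ (1 / r)

/-- `T ∈ 𝔊^r(𝓗)`: `T` is compact and `∑ s_k(T)^r < ∞`. -/
def MemSchatten (r : ℝ) (T : 𝓗 →L[ℂ] 𝓗) : Prop :=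
  IsCompactOperator T ∧ schattenNorm r T < ∞

end Schatten

/-- `ρ` is the density of the operator `γ`: for some orthonormal system `(u_j)` and coefficients
`c_j ∈ ℂ` one has `γ = ∑_j c_j |u_j⟩⟨u_j|` (strongly) and `ρ = ∑_j c_j |u_j|²` almost everywhere.
For compact `γ` this determines `ρ` almost everywhere. -/
def IsDensity {n : ℕ} (γ : L2 n →L[ℂ] L2 n) (ρ : Rn n → ℂ) : Prop :=
  ∃ (J : Type) (u : J → L2 n) (c : J → ℂ), Orthonormal ℂ u ∧
    (∀ f : L2 n, HasSum (fun j => (c j * ⟪u j, f⟫_ℂ) • u j) (γ f)) ∧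
    ∀ᵐ x : Rn n, HasSum (fun j => c j * ((‖u j x‖ ^ 2 : ℝ) : ℂ)) (ρ x)

/-- The norm of `L^p_t L^q_x(𝕋 × ℝⁿ)`, with `𝕋` represented by `(-π, π]`. -/
def mixedNorm {n : ℕ} (p q : ℝ≥0∞) (ρ : ℝ → Rn n → ℂ) : ℝ≥0∞ :=
  eLpNorm (fun t => eLpNorm (ρ t) q volume) p (volume.restrict (Set.Ioc (-Real.pi) Real.pi))

end HermiteSchatten

end

/-! The supremum is already infinite along spectral projections. Let `P_K` project onto the span of
the `Φ_α` with all `α_i < K`. It commutes with the propagator (`evolve_spectralProj`), so its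
density `ρ_K = ∑ Φ_α²` does not move, and the time norm only costs a factor `(2π)^{1/p} ≥ 1`. Its
rank is `K^n`, so its `𝔖^r` norm is `K^{n/r}`.

For the `L^q` norm the point is concentration. The second moment of `Φ_α²` is `|α| + n/2 ≤ nK`, so
by Chebyshev at least half of its mass lies in a ball `B` of radius `√(2nK)`
(`half_le_setIntegral_phiSq`). Summing over `α` and applying Hölder on `B`, whose volume is of order
`K^{n/2}`, gives `K^n / 2 ≤ ‖ρ_K‖_q |B|^{1-1/q}`, that is `‖ρ_K‖_q ≥ c K^{n(1+1/q)/2}`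
(`exists_le_eLpNorm_spectralDensity`). The quotient is then at least `c K^ε` with `ε = n(1+1/q)/2 -
n/r`, and `ε > 0` exactly when `r > 2q/(q+1)`. -/

namespace HermiteSchatten

/-! ### Schatten norms of finite-rank orthogonal projections -/

section Projections

variable {𝓗 : Type*} [NormedAddCommGroup 𝓗] [InnerProductSpace ℂ 𝓗]

lemma starProjection_span_apply {ι : Type*} {v : ι → 𝓗} (hv : Orthonormal ℂ v) (s : Finset ι)
    [DecidableEq 𝓗] (f : 𝓗) :
    (Submodule.span ℂ (s.image v : Set 𝓗)).starProjection f = ∑ a : s, ⟪v a, f⟫_ℂ • v a := by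
  rw [(OrthonormalBasis.span hv s).starProjection_eq_sum_rankOne]
  simp [InnerProductSpace.rankOne_apply]

lemma finrank_span_orthonormal {ι : Type*} {v : ι → 𝓗} (hv : Orthonormal ℂ v) (s : Finset ι)
    [DecidableEq 𝓗] :
    Module.finrank ℂ (Submodule.span ℂ (s.image v : Set 𝓗)) = s.card := by
  rw [Module.finrank_eq_card_basis (OrthonormalBasis.span hv s).toBasis, Fintype.card_coe]

lemma isCompactOperator_starProjection (U : Submodule ℂ 𝓗) [FiniteDimensional ℂ U] :
    IsCompactOperator U.starProjection := by
  have : IsCompactOperator (id : U → U) :=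
    isCompactOperator_id_iff_finiteDimensional (𝕜 := ℂ).2 inferInstance
  exact (this.comp_clm U.orthogonalProjectionOnto).clm_comp U.subtypeL

variable [CompleteSpace 𝓗]

lemma abs_starProjection (U : Submodule ℂ 𝓗) [U.HasOrthogonalProjection] :
    CFC.abs (U.starProjection : 𝓗 →L[ℂ] 𝓗) = U.starProjection := by
  apply CFC.abs_of_nonneg
  rw [ContinuousLinearMap.nonneg_iff_isPositive]
  exact .of_isStarProjection isStarProjection_starProjection

/-- A projection is its own absolute value, and its only nonzero eigenvalue can be `1`, with
eigenspace `U`. -/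
lemma schattenNorm_starProjection {r : ℝ} (hr : 0 < r) (U : Submodule ℂ 𝓗)
    [FiniteDimensional ℂ U] :
    schattenNorm r (U.starProjection : 𝓗 →L[ℂ] 𝓗) =
      (Module.finrank ℂ U : ℝ≥0∞) ^ (1 / r) := by
  rw [schattenNorm, abs_starProjection, tsum_eq_single 1]
  · have h : Module.End.eigenspace ((U.starProjection : 𝓗 →L[ℂ] 𝓗) : 𝓗 →ₗ[ℂ] 𝓗)
        (((1 : ℝ≥0) : ℝ) : ℂ) = U := by
      ext x
      rw [Module.End.mem_eigenspace_iff]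
      simp [Submodule.starProjection_eq_self_iff]
    rw [h]
    simp
  · intro s hs
    rcases eq_or_ne s 0 with rfl | h0
    -- The kernel is harmless whatever its dimension, because `0 ^ r = 0`.
    · simp [hr]
    · have h : Module.End.eigenspace ((U.starProjection : 𝓗 →L[ℂ] 𝓗) : 𝓗 →ₗ[ℂ] 𝓗)
          ((s : ℝ) : ℂ) = ⊥ := by
        rw [eq_bot_iff]
        intro x hx
        rw [Module.End.mem_eigenspace_iff] at hx
        have hx' : U.starProjection x = ((s : ℝ) : ℂ) • x := hx
        have hxU : x ∈ U := by
          have h1 : ((s : ℝ) : ℂ) • x ∈ U := hx' ▸ U.starProjection_apply_mem x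
          exact (U.smul_mem_iff (by exact_mod_cast h0)).1 h1
        rw [Submodule.starProjection_eq_self_iff.2 hxU] at hx'
        have h2 : (1 - ((s : ℝ) : ℂ)) • x = 0 := by
          rw [sub_smul, one_smul, ← hx', sub_self]
        rcases smul_eq_zero.1 h2 with h3 | h3
        · exact absurd (by exact_mod_cast (sub_eq_zero.1 h3).symm) hs
        · simpa using h3
      rw [h]
      simp

end Projections

/-! ### Spectral projections of `H` and their stationary densities -/

section Evolution

open Classical in
/-- The orthogonal projection onto the span of the `Φ_α` with `α ∈ s`. -/
noncomputable def spectralProj (n : ℕ) (s : Finset (Fin n → ℕ)) : L2 n →L[ℂ] L2 n :=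
  (Submodule.span ℂ (s.image (PhiL2 n) : Set (L2 n))).starProjection

lemma spectralProj_apply (n : ℕ) (s : Finset (Fin n → ℕ)) (f : L2 n) :
    spectralProj n s f = ∑ α : s, ⟪PhiL2 n α, f⟫_ℂ • PhiL2 n α := by
  classical
  rw [← starProjection_span_apply (orthonormal_PhiL2 n) s f]
  unfold spectralProj
  congr!

lemma propagator_PhiL2 (n : ℕ) (t : ℝ) (α : Fin n → ℕ) :
    propagator n t (PhiL2 n α) = phase n t α • PhiL2 n α := by
  refine (hasSum_propagator n t (PhiL2 n α)).unique ?_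
  convert hasSum_single α ?_ using 1
  · simp [inner_self_eq_norm_sq_to_K, (orthonormal_PhiL2 n).1]
  · intro β hβ
    rw [(orthonormal_PhiL2 n).2 hβ]
    simp

lemma inner_PhiL2_propagator (n : ℕ) (t : ℝ) (α : Fin n → ℕ) (f : L2 n) :
    ⟪PhiL2 n α, propagator n t f⟫_ℂ = phase n t α * ⟪PhiL2 n α, f⟫_ℂ := by
  have h := (hasSum_propagator n t f).mapL (innerSL ℂ (PhiL2 n α))
  refine h.unique ?_
  convert hasSum_single α ?_ using 1
  · simp [inner_self_eq_norm_sq_to_K, (orthonormal_PhiL2 n).1]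
  · intro β hβ
    simp [(orthonormal_PhiL2 n).2 hβ.symm]

lemma phase_neg_mul_phase (n : ℕ) (t : ℝ) (α : Fin n → ℕ) :
    phase n (-t) α * phase n t α = 1 := by
  rw [phase, phase, ← Complex.exp_add, ← Complex.exp_zero]
  congr 1
  push_cast
  ring

/-- Spectral projections of `H` are invariant under the evolution. -/
lemma evolve_spectralProj (n : ℕ) (t : ℝ) (s : Finset (Fin n → ℕ)) :
    evolve n t (spectralProj n s) = spectralProj n s := by
  ext1 f
  simp only [evolve, ContinuousLinearMap.comp_apply, spectralProj_apply, map_sum, map_smul,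
    propagator_PhiL2, inner_PhiL2_propagator, smul_smul]
  refine Finset.sum_congr rfl fun α _ => ?_
  rw [mul_right_comm, phase_neg_mul_phase, one_mul]

/-- The density of the spectral projection. -/
noncomputable def spectralDensity (n : ℕ) (s : Finset (Fin n → ℕ)) (x : Rn n) : ℂ :=
  ∑ α ∈ s, Phi n α x * Phi n α x

lemma isDensity_spectralProj (n : ℕ) (s : Finset (Fin n → ℕ)) :
    IsDensity (spectralProj n s) (spectralDensity n s) := by
  refine ⟨s, fun α => PhiL2 n α, fun _ => 1,
    (orthonormal_PhiL2 n).comp _ Subtype.val_injective, fun f => ?_, ?_⟩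
  · rw [spectralProj_apply]
    simpa using hasSum_fintype fun α : s => ⟪PhiL2 n α, f⟫_ℂ • PhiL2 n (α : Fin n → ℕ)
  · have h : ∀ᵐ x : Rn n, ∀ α : s, PhiL2 n (α : Fin n → ℕ) x = Phi n α x :=
      ae_all_iff.2 fun α => (memLp_Phi n α).coeFn_toLp
    filter_upwards [h] with x hx
    have e : spectralDensity n s x =
        ∑ α : s, (1 : ℂ) * ((‖PhiL2 n (α : Fin n → ℕ) x‖ ^ 2 : ℝ) : ℂ) := by
      rw [spectralDensity, ← Finset.sum_coe_sort]
      refine Finset.sum_congr rfl fun α _ => ?_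
      rw [hx, one_mul, Complex.ofReal_pow, ← Complex.mul_conj', conj_Phi]
    rw [e]
    exact hasSum_fintype _

lemma schattenNorm_spectralProj (n : ℕ) {r : ℝ} (hr : 0 < r) (s : Finset (Fin n → ℕ)) :
    schattenNorm r (spectralProj n s) = (s.card : ℝ≥0∞) ^ (1 / r) := by
  classical
  rw [spectralProj, schattenNorm_starProjection hr,
    finrank_span_orthonormal (orthonormal_PhiL2 n)]

lemma memSchatten_spectralProj (n : ℕ) {r : ℝ} (hr : 0 < r) (s : Finset (Fin n → ℕ)) :
    MemSchatten r (spectralProj n s) := by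
  refine ⟨isCompactOperator_starProjection _, ?_⟩
  rw [schattenNorm_spectralProj n hr]
  exact ENNReal.rpow_lt_top_of_nonneg (by positivity) (ENNReal.natCast_ne_top _)

lemma spectralProj_ne_zero (n : ℕ) {s : Finset (Fin n → ℕ)} (hs : s.Nonempty) :
    spectralProj n s ≠ 0 := by
  intro h
  have h1 := schattenNorm_spectralProj n one_pos s
  -- Trace norms tell the two apart: writing `0` as the projection onto `⊥` gives `0`, against the
  -- positive cardinality of `s`.
  rw [h, ← Submodule.starProjection_bot, schattenNorm_starProjection one_pos] at h1
  simp only [finrank_bot, Nat.cast_zero, div_one, ENNReal.rpow_one] at h1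
  exact hs.card_pos.ne (by exact_mod_cast h1)

end Evolution

/-! ### Second moments of Hermite functions and concentration of mass -/

section Moments

/-- Three-term recurrence, from the recursive definition and `H_k' = 2k H_{k-1}`. At `k = 0` the
truncated index `k - 1` is harmless, its coefficient being zero. -/
lemma X_mul_hermitePoly (k : ℕ) :
    Polynomial.X * hermitePoly k = Polynomial.C (1 / 2) * hermitePoly (k + 1) +
      Polynomial.C (k : ℝ) * hermitePoly (k - 1) := by
  have h2 : (Polynomial.C (1 / 2) : ℝ[X]) * Polynomial.C 2 = 1 := by
    rw [← Polynomial.C_mul]; norm_num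
  have e : hermitePoly (k + 1) = Polynomial.C 2 * Polynomial.X * hermitePoly k -
    Polynomial.derivative (hermitePoly k) := rfl
  cases k with
  | zero =>
    rw [e]
    simp only [hermitePoly, Polynomial.derivative_one, Nat.cast_zero, map_zero, zero_mul]
    linear_combination (-Polynomial.X) * h2
  | succ k =>
    rw [e, derivative_hermitePoly, Nat.add_sub_cancel, Polynomial.C_mul]
    push_cast
    linear_combination (-(Polynomial.X * hermitePoly (k + 1)) +
      Polynomial.C ((k : ℝ) + 1) * hermitePoly k) * h2

/-- Squaring the recurrence leaves two diagonal terms, contributing `(k+1)/2` and `k/2` times the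
squared norm of `H_k`; orthogonality removes the cross term. -/
lemma integral_sq_mul_hermitePoly (k : ℕ) :
    ∫ x : ℝ, ((Polynomial.X * hermitePoly k) * (Polynomial.X * hermitePoly k)).eval x *
      Real.exp (-x ^ 2) = (k + 1 / 2) * (2 ^ k * Real.sqrt Real.pi * (k.factorial : ℝ)) := by
  have e : ∀ x : ℝ, ((Polynomial.X * hermitePoly k) * (Polynomial.X * hermitePoly k)).eval x *
      Real.exp (-x ^ 2) =
      1 / 4 * ((hermitePoly (k + 1) * hermitePoly (k + 1)).eval x * Real.exp (-x ^ 2)) +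
      (k * ((hermitePoly (k + 1) * hermitePoly (k - 1)).eval x * Real.exp (-x ^ 2)) +
      k ^ 2 * ((hermitePoly (k - 1) * hermitePoly (k - 1)).eval x * Real.exp (-x ^ 2))) := by
    intro x
    rw [X_mul_hermitePoly]
    simp only [Polynomial.eval_mul, Polynomial.eval_add, Polynomial.eval_C]
    ring
  simp_rw [e]
  have i := fun j l => integrable_poly_gauss (hermitePoly j * hermitePoly l)
  rw [integral_add, integral_add, integral_const_mul, integral_const_mul, integral_const_mul]
  rotate_left
  · exact (i _ _).const_mul _
  · exact (i _ _).const_mul _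
  · exact (i _ _).const_mul _
  · exact ((i _ _).const_mul _).add ((i _ _).const_mul _)
  simp only [integral_hermitePoly_mul]
  cases k with
  | zero => simp; ring
  | succ k =>
    simp only [if_true]
    rw [if_neg (show ¬ k + 1 + 1 = k + 1 - 1 by omega), Nat.add_sub_cancel]
    simp only [Nat.factorial_succ]
    push_cast
    ring

lemma sq_mul_hermiteFun (k : ℕ) (x : ℝ) :
    x ^ 2 * (hermiteFun k x * hermiteFun k x) =
      ((Real.sqrt (2 ^ k * Real.sqrt Real.pi * (k.factorial : ℝ)))⁻¹ *
        (Real.sqrt (2 ^ k * Real.sqrt Real.pi * (k.factorial : ℝ)))⁻¹) *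
        (((Polynomial.X * hermitePoly k) * (Polynomial.X * hermitePoly k)).eval x *
          Real.exp (-x ^ 2)) := by
  rw [hermiteFun_mul]
  simp only [Polynomial.eval_mul, Polynomial.eval_X]
  ring

lemma integrable_sq_mul_hermiteFun (k : ℕ) :
    Integrable (fun x : ℝ => x ^ 2 * (hermiteFun k x * hermiteFun k x)) := by
  simp_rw [sq_mul_hermiteFun]
  exact (integrable_poly_gauss _).const_mul _

lemma integral_sq_mul_hermiteFun (k : ℕ) :
    ∫ x : ℝ, x ^ 2 * (hermiteFun k x * hermiteFun k x) = k + 1 / 2 := by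
  simp_rw [sq_mul_hermiteFun]
  rw [integral_const_mul, integral_sq_mul_hermitePoly]
  have hpos : 0 < 2 ^ k * Real.sqrt Real.pi * (k.factorial : ℝ) := by positivity
  rw [← mul_inv, Real.mul_self_sqrt hpos.le]
  field_simp

/-- `|Φ_α|²` as a real function. -/
noncomputable def phiSq (n : ℕ) (α : Fin n → ℕ) (x : Rn n) : ℝ :=
  ∏ j, (hermiteFun (α j) (x j) * hermiteFun (α j) (x j))

lemma Phi_mul_self (n : ℕ) (α : Fin n → ℕ) (x : Rn n) :
    Phi n α x * Phi n α x = (phiSq n α x : ℂ) := by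
  rw [Phi, phiSq, Finset.prod_mul_distrib]
  push_cast
  rfl

lemma phiSq_nonneg (n : ℕ) (α : Fin n → ℕ) (x : Rn n) : 0 ≤ phiSq n α x :=
  Finset.prod_nonneg fun _ _ => mul_self_nonneg _

lemma integrable_euclidean_prod {n : ℕ} {f : Fin n → ℝ → ℝ} (hf : ∀ j, Integrable (f j)) :
    Integrable (fun x : Rn n => ∏ j, f j (x j)) := by
  have h : Integrable (fun x : Fin n → ℝ => ∏ j, f j (x j)) volume := Integrable.fintype_prod hf
  exact ((PiLp.volume_preserving_ofLp (Fin n)).integrable_comp h.aestronglyMeasurable).mpr h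

lemma integral_euclidean_prod {n : ℕ} (f : Fin n → ℝ → ℝ) :
    ∫ x : Rn n, ∏ j, f j (x j) = ∏ j, ∫ y, f j y := by
  have h := (PiLp.volume_preserving_ofLp (Fin n)).integral_comp
    (MeasurableEquiv.toLp 2 (Fin n → ℝ)).symm.measurableEmbedding
    (fun y : Fin n → ℝ => ∏ j, f j (y j))
  exact h.trans (integral_fintype_prod_volume_eq_prod f)

lemma integrable_phiSq (n : ℕ) (α : Fin n → ℕ) : Integrable (phiSq n α) :=
  integrable_euclidean_prod (f := fun j y => hermiteFun (α j) y * hermiteFun (α j) y)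
    fun _ => integrable_hermiteFun_mul _ _

lemma integral_phiSq (n : ℕ) (α : Fin n → ℕ) : ∫ x, phiSq n α x = 1 := by
  refine (integral_euclidean_prod
    (fun j y => hermiteFun (α j) y * hermiteFun (α j) y)).trans ?_
  simp [integral_hermiteFun_mul]

/-- Absorbing the weight into the `i`-th factor keeps the product form, so that Fubini reduces the
moment to one dimension. -/
lemma coord_sq_mul_phiSq (n : ℕ) (α : Fin n → ℕ) (i : Fin n) (x : Rn n) :
    x i ^ 2 * phiSq n α x = ∏ j, (fun y => (if j = i then y ^ 2 else 1) *
      (hermiteFun (α j) y * hermiteFun (α j) y)) (x j) := by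
  simp only [phiSq, Finset.prod_mul_distrib]
  simp

lemma integrable_coord_sq_mul_phiSq (n : ℕ) (α : Fin n → ℕ) (i : Fin n) :
    Integrable (fun x : Rn n => x i ^ 2 * phiSq n α x) := by
  simp_rw [coord_sq_mul_phiSq]
  refine integrable_euclidean_prod (f := fun j y => (if j = i then y ^ 2 else 1) *
      (hermiteFun (α j) y * hermiteFun (α j) y)) fun j => ?_
  by_cases h : j = i
  · simpa [h] using integrable_sq_mul_hermiteFun (α i)
  · simpa [h] using integrable_hermiteFun_mul (α j) (α j)

lemma integral_coord_sq_mul_phiSq (n : ℕ) (α : Fin n → ℕ) (i : Fin n) :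
    ∫ x : Rn n, x i ^ 2 * phiSq n α x = α i + 1 / 2 := by
  simp_rw [coord_sq_mul_phiSq]
  rw [integral_euclidean_prod fun j y => (if j = i then y ^ 2 else 1) *
      (hermiteFun (α j) y * hermiteFun (α j) y), Finset.prod_eq_single i]
  · simpa using integral_sq_mul_hermiteFun (α i)
  · intro j _ h
    simpa [h] using integral_hermiteFun_mul (α j) (α j)
  · simp

lemma norm_sq_mul_phiSq (n : ℕ) (α : Fin n → ℕ) (x : Rn n) :
    ‖x‖ ^ 2 * phiSq n α x = ∑ i, x i ^ 2 * phiSq n α x := by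
  rw [EuclideanSpace.real_norm_sq_eq, Finset.sum_mul]

lemma integrable_norm_sq_mul_phiSq (n : ℕ) (α : Fin n → ℕ) :
    Integrable (fun x : Rn n => ‖x‖ ^ 2 * phiSq n α x) := by
  simp_rw [norm_sq_mul_phiSq]
  exact integrable_finsetSum _ fun i _ => integrable_coord_sq_mul_phiSq n α i

lemma integral_norm_sq_mul_phiSq (n : ℕ) (α : Fin n → ℕ) :
    ∫ x : Rn n, ‖x‖ ^ 2 * phiSq n α x = ∑ i, ((α i : ℝ) + 1 / 2) := by
  simp_rw [norm_sq_mul_phiSq]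
  rw [integral_finsetSum _ fun i _ => integrable_coord_sq_mul_phiSq n α i]
  simp_rw [integral_coord_sq_mul_phiSq]

/-- If `α_i < K` for all `i`, at least half of the mass of `|Φ_α|²` lies in the ball of radius
`√(2nK)`. -/
lemma half_le_setIntegral_phiSq {n : ℕ} (hn : 1 ≤ n) {K : ℕ} {α : Fin n → ℕ}
    (hα : ∀ i, α i < K) :
    1 / 2 ≤ ∫ x in Metric.ball (0 : Rn n) (Real.sqrt (2 * n * K)), phiSq n α x := by
  have hK : 0 < K := (Nat.zero_le _).trans_lt (hα ⟨0, hn⟩)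
  have hR : (0 : ℝ) < 2 * n * K := by positivity
  set B := Metric.ball (0 : Rn n) (Real.sqrt (2 * n * K))
  have hsplit := integral_add_compl (μ := volume) (s := B) measurableSet_ball
    (integrable_phiSq n α)
  rw [integral_phiSq] at hsplit
  have hsq : ∫ x : Rn n, ‖x‖ ^ 2 * phiSq n α x ≤ n * K := by
    rw [integral_norm_sq_mul_phiSq]
    calc ∑ i, ((α i : ℝ) + 1 / 2) ≤ ∑ _i : Fin n, (K : ℝ) := by
          refine Finset.sum_le_sum fun i _ => ?_
          have : (α i : ℝ) + 1 ≤ K := by exact_mod_cast hα i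
          linarith
      _ = n * K := by simp
  -- Chebyshev: `‖x‖² ≥ 2nK` off the ball, twice the bound on the second moment.
  have htail : (2 * n * K) * ∫ x in Bᶜ, phiSq n α x ≤ n * K := by
    rw [← integral_const_mul]
    refine le_trans ?_ ((setIntegral_le_integral (s := Bᶜ) (integrable_norm_sq_mul_phiSq n α)
      (ae_of_all _ fun x => mul_nonneg (sq_nonneg _) (phiSq_nonneg n α x))).trans hsq)
    refine setIntegral_mono_on ((integrable_phiSq n α).const_mul _).integrableOn
      (integrable_norm_sq_mul_phiSq n α).integrableOn measurableSet_ball.compl fun x hx => ?_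
    refine mul_le_mul_of_nonneg_right ?_ (phiSq_nonneg n α x)
    have hx' : Real.sqrt (2 * n * K) ≤ ‖x‖ := by simpa [B] using hx
    exact (Real.sqrt_le_left (norm_nonneg x)).1 hx'
  have : ∫ x in Bᶜ, phiSq n α x ≤ 1 / 2 := by
    by_contra! h
    nlinarith
  linarith

end Moments

/-! ### Lower bound for the `L^q` norm of the density -/

section LowerBound

/-- The multi-indices with all entries `< K`. -/
def box (n K : ℕ) : Finset (Fin n → ℕ) := Fintype.piFinset fun _ => Finset.range K

lemma mem_box {n K : ℕ} {α : Fin n → ℕ} : α ∈ box n K ↔ ∀ i, α i < K := by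
  simp [box]

lemma card_box (n K : ℕ) : (box n K).card = K ^ n := by
  simp [box]

lemma spectralDensity_eq_ofReal (n : ℕ) (s : Finset (Fin n → ℕ)) (x : Rn n) :
    spectralDensity n s x = ((∑ α ∈ s, phiSq n α x : ℝ) : ℂ) := by
  simp [spectralDensity, Phi_mul_self]

lemma continuous_spectralDensity (n : ℕ) (s : Finset (Fin n → ℕ)) :
    Continuous (spectralDensity n s) :=
  continuous_finsetSum _ fun α _ => (continuous_Phi n α).mul (continuous_Phi n α)

/-- The density is nonnegative, so its `L¹` norm is its integral, to which each of the `K^n` terms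
contributes at least `1/2`. -/
lemma mass_le_eLpNorm_one {n : ℕ} (hn : 1 ≤ n) (K : ℕ) :
    ENNReal.ofReal ((K : ℝ) ^ n / 2) ≤ eLpNorm (spectralDensity n (box n K)) 1
      (volume.restrict (Metric.ball (0 : Rn n) (Real.sqrt (2 * n * K)))) := by
  have hnn : ∀ x : Rn n, 0 ≤ ∑ α ∈ box n K, phiSq n α x := fun x =>
    Finset.sum_nonneg fun α _ => phiSq_nonneg n α x
  have hint : Integrable (fun x : Rn n => ∑ α ∈ box n K, phiSq n α x)
      (volume.restrict (Metric.ball (0 : Rn n) (Real.sqrt (2 * n * K)))) :=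
    (integrable_finsetSum _ fun α _ => integrable_phiSq n α).integrableOn
  have e : eLpNorm (spectralDensity n (box n K)) 1
      (volume.restrict (Metric.ball (0 : Rn n) (Real.sqrt (2 * n * K)))) =
      ENNReal.ofReal (∫ x in Metric.ball (0 : Rn n) (Real.sqrt (2 * n * K)),
        ∑ α ∈ box n K, phiSq n α x) := by
    rw [eLpNorm_one_eq_lintegral_enorm, ofReal_integral_eq_lintegral_ofReal hint (ae_of_all _ hnn)]
    refine lintegral_congr fun x => ?_
    rw [spectralDensity_eq_ofReal, ← ofReal_norm, Complex.norm_real,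
      Real.norm_of_nonneg (hnn x)]
  rw [e]
  refine ENNReal.ofReal_le_ofReal ?_
  rw [integral_finsetSum _ fun α _ => (integrable_phiSq n α).integrableOn]
  calc (K : ℝ) ^ n / 2 = ∑ _α ∈ box n K, (1 / 2 : ℝ) := by
        rw [Finset.sum_const, card_box]; simp; ring
    _ ≤ _ := Finset.sum_le_sum fun α hα => half_le_setIntegral_phiSq hn (mem_box.1 hα)

/-- The `L^q` norm of the density of the box projection is at least a constant times
`K^{n(1+1/q)/2}`. -/
lemma exists_le_eLpNorm_spectralDensity {n : ℕ} (hn : 1 ≤ n) {q : ℝ≥0∞} (hq : 1 ≤ q) :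
    ∃ c : ℝ, 0 < c ∧ ∀ K : ℕ, 1 ≤ K →
      ENNReal.ofReal (c * (K : ℝ) ^ ((n : ℝ) * (1 + 1 / q.toReal) / 2)) ≤
        eLpNorm (spectralDensity n (box n K)) q volume := by
  have : Nonempty (Fin n) := ⟨⟨0, hn⟩⟩
  set V : ℝ := (volume (Metric.ball (0 : Rn n) 1)).toReal
  have hV : 0 < V := ENNReal.toReal_pos (Metric.measure_ball_pos _ _ one_pos).ne'
    measure_ball_lt_top.ne
  -- The Hölder exponent between `L¹` and `L^q`. For `q = ∞`, `toReal` and division by zero give `θ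
  -- = 1`, as they should.
  set θ : ℝ := 1 - 1 / q.toReal
  have hθ : 0 ≤ θ := by
    rcases eq_or_ne q ∞ with rfl | hqt
    · simp [θ]
    · have : 1 ≤ q.toReal := by simpa using ENNReal.toReal_mono hqt hq
      have := (div_le_one (by linarith)).2 this
      simp only [θ]; linarith
  set D : ℝ := ((Real.sqrt (2 * n)) ^ n * V) ^ θ
  have hD : 0 < D := by positivity
  refine ⟨1 / 2 / D, by positivity, fun K hK => ?_⟩
  have hK0 : (0 : ℝ) < K := by exact_mod_cast hK
  set B := Metric.ball (0 : Rn n) (Real.sqrt (2 * n * K))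
  have hvol : volume B = ENNReal.ofReal ((Real.sqrt (2 * n)) ^ n * V * (K : ℝ) ^ ((n : ℝ) / 2)) := by
    rw [Measure.addHaar_ball _ _ (Real.sqrt_nonneg _), finrank_euclideanSpace_fin,
      ← ENNReal.ofReal_toReal (measure_ball_lt_top (μ := volume) (x := (0 : Rn n)) (r := 1)).ne,
      ← ENNReal.ofReal_mul (by positivity)]
    congr 1
    rw [Real.sqrt_mul (by positivity), mul_pow, Real.sqrt_eq_rpow (K : ℝ), ← Real.rpow_natCast
      ((K : ℝ) ^ _), ← Real.rpow_mul hK0.le]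
    rw [show (1 / 2 : ℝ) * n = n / 2 by ring]
    ring
  have hvolθ : volume B ^ θ = ENNReal.ofReal (D * (K : ℝ) ^ ((n : ℝ) / 2 * θ)) := by
    rw [hvol, ENNReal.ofReal_rpow_of_nonneg (by positivity) hθ,
      Real.mul_rpow (by positivity) (by positivity), ← Real.rpow_mul hK0.le]
  -- Hölder on the ball, whose volume enters with the power `θ`.
  have hH := (mass_le_eLpNorm_one hn K).trans
    (eLpNorm_le_eLpNorm_mul_rpow_measure_univ hq
      (continuous_spectralDensity n (box n K)).aestronglyMeasurable)
  rw [Measure.restrict_apply_univ, ENNReal.toReal_one, div_one, hvolθ] at hH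
  have hpos : 0 < D * (K : ℝ) ^ ((n : ℝ) / 2 * θ) := by positivity
  rw [← ENNReal.div_le_iff (by simpa using hpos) ENNReal.ofReal_ne_top,
    ← ENNReal.ofReal_div_of_pos hpos] at hH
  refine le_trans (le_of_eq ?_) (hH.trans (eLpNorm_mono_measure _ Measure.restrict_le_self))
  congr 1
  -- The mass exponent `n` splits into the claimed exponent and that of `|B|^θ`.
  have e : (K : ℝ) ^ n = (K : ℝ) ^ ((n : ℝ) * (1 + 1 / q.toReal) / 2) *
      (K : ℝ) ^ ((n : ℝ) / 2 * θ) := by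
    rw [← Real.rpow_add hK0, ← Real.rpow_natCast]
    congr 1
    simp only [θ]; ring
  rw [e]
  field_simp

/-- The time integration multiplies by `(2π)^{1/p} ≥ 1`, the exponent being `0` for `p = ∞`. -/
lemma eLpNorm_le_mixedNorm_const {n : ℕ} {p : ℝ≥0∞} (hp : 1 ≤ p) (q : ℝ≥0∞) (f : Rn n → ℂ) :
    eLpNorm f q volume ≤ mixedNorm p q fun _ => f := by
  have hvol : volume.restrict (Set.Ioc (-Real.pi) Real.pi) Set.univ =
      ENNReal.ofReal (2 * Real.pi) := by
    rw [Measure.restrict_apply_univ, Real.volume_Ioc]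
    congr 1; ring
  have h1 : 1 ≤ ENNReal.ofReal (2 * Real.pi) := by
    rw [ENNReal.one_le_ofReal]
    linarith [Real.pi_gt_three]
  rw [mixedNorm, eLpNorm_const _ (zero_lt_one.trans_le hp).ne', hvol, enorm_eq_self]
  · exact le_mul_of_one_le_right' (by
      simpa using ENNReal.rpow_le_rpow h1 (by positivity : 0 ≤ 1 / p.toReal))
  · intro h
    rw [h] at hvol
    rw [← hvol] at h1
    simp at h1

end LowerBound

/-! ### Comparison of exponents and conclusion -/

lemma lt_of_two_div_lt_ofReal {q : ℝ≥0∞} (hq : 1 ≤ q) {r : ℝ}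
    (hr : 2 / (1 + 1 / q) < ENNReal.ofReal r) : 2 / (1 + 1 / q.toReal) < r := by
  have ha : (0 : ℝ) ≤ 1 / q.toReal := by positivity
  have e : 1 / q = ENNReal.ofReal (1 / q.toReal) := by
    rcases eq_or_ne q ∞ with rfl | hqt
    · simp
    · rw [ENNReal.ofReal_div_of_pos
        (ENNReal.toReal_pos (zero_lt_one.trans_le hq).ne' hqt), ENNReal.ofReal_toReal hqt,
        ENNReal.ofReal_one]
  rw [e, ← ENNReal.ofReal_one, ← ENNReal.ofReal_add zero_le_one ha,
    ← ENNReal.ofReal_ofNat 2, ← ENNReal.ofReal_div_of_pos (by linarith)] at hr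
  exact (ENNReal.ofReal_lt_ofReal_iff_of_nonneg (by positivity)).1 hr

end HermiteSchatten

open HermiteSchatten in
theorem proposition5p1 (n : ℕ) (hn : 1 ≤ n) (p q : ℝ≥0∞) (hp : 1 ≤ p) (hq : 1 ≤ q)
    (hpq : 2 / p + (n : ℝ≥0∞) / q = (n : ℝ≥0∞))
    -- `2 / (1 + 1 / q)` is `2q / (q + 1)`, which makes sense also for `q = ∞`
    (r : ℝ) (hr : 2 / (1 + 1 / q) < ENNReal.ofReal r) :
    (⨆ (γ₀ : HermiteSchatten.L2 n →L[ℂ] HermiteSchatten.L2 n)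
        (ρ : ℝ → HermiteSchatten.Rn n → ℂ)
        (_ : HermiteSchatten.MemSchatten r γ₀ ∧ γ₀ ≠ 0 ∧
          ∀ t : ℝ, HermiteSchatten.IsDensity (HermiteSchatten.evolve n t γ₀) (ρ t)),
      HermiteSchatten.mixedNorm p q ρ / HermiteSchatten.schattenNorm r γ₀) = ∞ := by
  have : 0 ≤ 1 / q.toReal := by positivity
  have hr' := lt_of_two_div_lt_ofReal hq hr
  have hr0 : 0 < r := lt_of_le_of_lt (by positivity) hr'
  have hn0 : (0 : ℝ) < n := by exact_mod_cast hn
  obtain ⟨c, hc, hK⟩ := exists_le_eLpNorm_spectralDensity hn hq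
  -- The growth exponent of the density in `K` minus that of the Schatten norm.
  set ε : ℝ := n * (1 + 1 / q.toReal) / 2 - n / r
  have hε : 0 < ε := by
    rw [div_lt_iff₀ (by positivity)] at hr'
    have h : ε = n * (r * (1 + 1 / q.toReal) - 2) / (2 * r) := by
      simp only [ε]; field_simp
    rw [h]
    have : 0 < r * (1 + 1 / q.toReal) - 2 := by linarith
    positivity
  have hlim : Tendsto (fun K : ℕ => ENNReal.ofReal (c * (K : ℝ) ^ ε)) atTop (𝓝 ∞) :=
    ENNReal.tendsto_ofReal_atTop.comp
      (((tendsto_rpow_atTop hε).comp tendsto_natCast_atTop_atTop).const_mul_atTop hc)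
  -- It suffices that the supremum dominates `c K^ε` for every `K ≥ 1`.
  refine top_le_iff.1 (le_of_tendsto hlim ?_)
  filter_upwards [eventually_ge_atTop 1] with K hK1
  have hK0 : (0 : ℝ) < K := by exact_mod_cast hK1
  refine le_iSup_of_le (spectralProj n (box n K)) (le_iSup_of_le
    (fun _ => spectralDensity n (box n K)) (le_iSup_of_le
    ⟨memSchatten_spectralProj n hr0 _, spectralProj_ne_zero n ⟨0, ?_⟩, fun t => ?_⟩ ?_))
  · exact mem_box.2 fun _ => hK1
  · rw [evolve_spectralProj]
    exact isDensity_spectralProj n _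
  · have hS : schattenNorm r (spectralProj n (box n K)) =
        ENNReal.ofReal ((K : ℝ) ^ ((n : ℝ) / r)) := by
      rw [schattenNorm_spectralProj n hr0, card_box, ← ENNReal.ofReal_natCast,
        ENNReal.ofReal_rpow_of_nonneg (by positivity) (by positivity), Nat.cast_pow,
        ← Real.rpow_natCast, ← Real.rpow_mul hK0.le, mul_one_div]
    rw [hS, ENNReal.le_div_iff_mul_le (Or.inl (by simp; positivity))
      (Or.inl ENNReal.ofReal_ne_top), ← ENNReal.ofReal_mul (by positivity), mul_assoc,
      ← Real.rpow_add hK0]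
    simp only [ε, sub_add_cancel]
    exact (hK K hK1).trans (eLpNorm_le_mixedNorm_const hp q _)
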